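/- Let $u\colon R\to U$ be a flat epimorphism of commutative rings, i.e. $U$ is a flat $R$-module via $u$ and the multiplication map $U\otimes_R U\to U$ is an isomorphism. Let $\mathbb G$ be the related Gabriel filter of ideals of $R$, that is, the set of all ideals $I\subseteq R$ such that $R/I\otimes_R U=0$. Assume that for every $I\in\mathbb G$ the quotient ring $R/I$ is semilocal of Krull dimension zero, i.e. it has only finitely many maximal ideals and all its prime ideals are maximal (the zero ring being allowed). An $R$-module $M$ is called $u$-divisible if it is a quotient $R$-module of (the underlying $R$-module of) a $U$-module, and $\mathbb G$-divisible if $R/I\otimes_R M=0$ for all $I\in\mathbb G$. Then an $R$-module $M$ is $u$-divisible if and only if it is $\mathbb G$-divisible. -/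

import Mathlib

open scoped TensorProduct

universe u v w x

/-- A commutative ring is semilocal if it has only finitely many maximal ideals. -/
def IsSemilocal (T : Type u) [CommRing T] : Prop :=
  Finite (MaximalSpectrum T)

/-- A commutative ring has Krull dimension zero, in the sense that all its prime ideals are
maximal (the zero ring is allowed). -/
def IsZeroDimensional (T : Type u) [CommRing T] : Prop :=
  ∀ p : Ideal T, p.IsPrime → p.IsMaximal

/-- The set `𝔾` of all ideals `I` of `R` with `R/I ⊗[R] U = 0`. If `R → U` is a flat epimorphism,
this is the perfect Gabriel filter of ideals related to it. -/
def relatedGabrielFilter (R : Type u) (U : Type v) [CommRing R] [CommRing U] [Algebra R U] :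
    Set (Ideal R) :=
  {I | Subsingleton ((R ⧸ I) ⊗[R] U)}

/-- `R` is `F`-h-nil: `R/I` is semilocal of Krull dimension zero for every `I ∈ F`. -/
def IsHNil {R : Type u} [CommRing R] (F : Set (Ideal R)) : Prop :=
  ∀ I ∈ F, IsSemilocal (R ⧸ I) ∧ IsZeroDimensional (R ⧸ I)

/-- An `R`-module `M` is `F`-divisible if `R/I ⊗[R] M = 0` for all `I ∈ F`. -/
def IsFilterDivisible {R : Type u} [CommRing R] (F : Set (Ideal R))
    (M : Type w) [AddCommGroup M] [Module R M] : Prop :=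
  ∀ I ∈ F, Subsingleton ((R ⧸ I) ⊗[R] M)

/-- For a ring homomorphism `u = algebraMap R U`, an `R`-module `M` is `u`-divisible if it is a
quotient `R`-module of a `U`-module `D` (with `R` acting on `D` through `u`). By
`isUDivisible_of_surjective` below, the choice of the universe of `D` is immaterial. -/
def IsUDivisible (R : Type u) (U : Type v) [CommRing R] [CommRing U] [Algebra R U]
    (M : Type w) [AddCommGroup M] [Module R M] : Prop :=
  ∃ (D : Type (max v w)) (_ : AddCommGroup D) (_ : Module U D) (_ : Module R D)
    (_ : IsScalarTower R U D) (f : D →ₗ[R] M), Function.Surjective f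

/-- A quotient of a `U`-module in any universe is `u`-divisible. -/
theorem isUDivisible_of_surjective {R : Type u} {U : Type v} [CommRing R] [CommRing U]
    [Algebra R U] {M : Type w} [AddCommGroup M] [Module R M] {D : Type x} [AddCommGroup D]
    [Module U D] [Module R D] [IsScalarTower R U D] (f : D →ₗ[R] M)
    (hf : Function.Surjective f) : IsUDivisible R U M := by
  classical
  choose s hs using hf
  refine ⟨M →₀ U, inferInstance, inferInstance, inferInstance, inferInstance,
    f ∘ₗ (Finsupp.linearCombination U s).restrictScalars R, fun m => ⟨Finsupp.single m 1, ?_⟩⟩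
  simp [hs]

/-! The substantial direction sends `1 : U` to any prescribed `m` in a `𝔾`-divisible `M`; summing
such maps covers `M`. Write `1` for the image of `R` in `U`. The h-nil condition splits `U ⧸ 1` into
`p`-primary parts, so `LinearMap.exists_extend_of_iSupIndep` allows extension over each part
separately. Since `p` contains a finitely generated member of `𝔾`, the preimage of a part lies in a
countably generated submodule of `U`.

On such a submodule a map is built step by step. Divisibility gives maps on finitely generated
submodules (`IsFilterDivisible.exists_fg_extend`), and a Mittag-Leffler argument based on flatness
(`IsFilterDivisible.exists_fg_extend_restrict`) makes successive choices compatible. -/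

theorem subsingleton_quotient_tensor_iff {R : Type u} [CommRing R] (I : Ideal R)
    (M : Type w) [AddCommGroup M] [Module R M] :
    Subsingleton ((R ⧸ I) ⊗[R] M) ↔ I • (⊤ : Submodule R M) = ⊤ := by
  rw [(TensorProduct.quotTensorEquivQuotSMul M I).toEquiv.subsingleton_congr,
    Submodule.Quotient.subsingleton_iff]

/-! ### The Gabriel filter and finiteness in `U` -/

section GabrielFilter

variable {R : Type u} {U : Type v} [CommRing R] [CommRing U] [Algebra R U]

theorem mem_relatedGabrielFilter_iff {I : Ideal R} :
    I ∈ relatedGabrielFilter R U ↔ I.map (algebraMap R U) = ⊤ := by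
  change Subsingleton _ ↔ _
  rw [subsingleton_quotient_tensor_iff, Ideal.smul_top_eq_map]
  exact Submodule.restrictScalars_eq_top_iff R U U

theorem relatedGabrielFilter_mono {I J : Ideal R} (hI : I ∈ relatedGabrielFilter R U)
    (hIJ : I ≤ J) : J ∈ relatedGabrielFilter R U := by
  rw [mem_relatedGabrielFilter_iff] at hI ⊢
  exact top_le_iff.mp (hI ▸ Ideal.map_mono hIJ)

theorem mul_mem_relatedGabrielFilter {I J : Ideal R} (hI : I ∈ relatedGabrielFilter R U)
    (hJ : J ∈ relatedGabrielFilter R U) : I * J ∈ relatedGabrielFilter R U := by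
  rw [mem_relatedGabrielFilter_iff] at *
  rw [Ideal.map_mul, hI, hJ, Ideal.top_mul]

theorem pow_mem_relatedGabrielFilter {I : Ideal R} (hI : I ∈ relatedGabrielFilter R U) (n : ℕ) :
    I ^ n ∈ relatedGabrielFilter R U := by
  rw [mem_relatedGabrielFilter_iff] at *
  rw [Ideal.map_pow, hI, Ideal.top_pow]

/-- If `I` generates the unit ideal of `U`, then the elements of `U` that `I` multiplies into the
image of `R` lie in a common finitely generated submodule. -/
theorem exists_fg_of_mem_relatedGabrielFilter {I : Ideal R}
    (hI : I ∈ relatedGabrielFilter R U) :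
    (∃ J ≤ I, J.FG ∧ J ∈ relatedGabrielFilter R U) ∧
    ∃ X : Submodule R U, X.FG ∧
      ∀ y : U, (∀ r ∈ I, r • y ∈ (1 : Submodule R U)) → y ∈ X := by
  have h1 : (1 : U) ∈ I • (⊤ : Submodule R U) := by
    rw [Ideal.smul_top_eq_map, mem_relatedGabrielFilter_iff.mp hI]
    exact Submodule.mem_top
  -- If `1 = ∑ rᵢ wᵢ` with `rᵢ ∈ I`, then `y = ∑ (rᵢ y) wᵢ` lies in the span of the `wᵢ`; `J` is
  -- spanned by the `rᵢ`. Replacing `1` by `z` permits induction on the sum.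
  suffices ∀ z ∈ I • (⊤ : Submodule R U), ∃ J ≤ I, J.FG ∧ z ∈ J.map (algebraMap R U) ∧
      ∃ X : Submodule R U, X.FG ∧
        ∀ y : U, (∀ r ∈ I, r • y ∈ (1 : Submodule R U)) → z * y ∈ X by
    obtain ⟨J, hJ, hJf, h1J, X, hX, h⟩ := this 1 h1
    exact ⟨⟨J, hJ, hJf, mem_relatedGabrielFilter_iff.mpr ((Ideal.eq_top_iff_one _).mpr h1J)⟩,
      X, hX, fun y hy => by simpa using h y hy⟩
  intro z hz
  induction hz using Submodule.smul_induction_on' with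
  | smul r hr w _ =>
    refine ⟨Ideal.span {r}, (Ideal.span_singleton_le_iff_mem _).mpr hr, ⟨{r}, by simp⟩, ?_,
      Submodule.span R {w}, ⟨{w}, by simp⟩, fun y hy => ?_⟩
    · rw [Algebra.smul_def]
      exact Ideal.mul_mem_right _ _ (Ideal.mem_map_of_mem _ (Ideal.mem_span_singleton_self r))
    · obtain ⟨s, hs⟩ := Submodule.mem_one.mp (hy r hr)
      rw [smul_mul_assoc, mul_comm, ← smul_mul_assoc, ← hs, ← Algebra.smul_def]
      exact Submodule.smul_mem _ _ (Submodule.mem_span_singleton_self w)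
  | add a _ b _ iha ihb =>
    obtain ⟨J, hJ, hJf, hJz, X, hX, h⟩ := iha
    obtain ⟨J', hJ', hJf', hJz', X', hX', h'⟩ := ihb
    refine ⟨J ⊔ J', sup_le hJ hJ', Submodule.FG.sup hJf hJf', ?_, X ⊔ X', hX.sup hX',
      fun y hy => ?_⟩
    · exact add_mem (Ideal.map_mono le_sup_left hJz) (Ideal.map_mono le_sup_right hJz')
    · rw [add_mul]
      exact add_mem ((le_sup_left : X ≤ X ⊔ X') (h y hy)) ((le_sup_right : X' ≤ X ⊔ X') (h' y hy))

/-- An element of a module that vanishes after the flat base change to `U` is annihilated by an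
ideal generating the unit ideal of `U`. -/
theorem torsionOf_mem_relatedGabrielFilter [Module.Flat R U] {V : Type*} [AddCommGroup V]
    [Module R V] {x : V} (hx : x ⊗ₜ[R] (1 : U) = 0) :
    Ideal.torsionOf R V x ∈ relatedGabrielFilter R U := by
  let f : (R ⧸ Ideal.torsionOf R V x) →ₗ[R] V :=
    (Submodule.subtype _) ∘ₗ (Ideal.quotTorsionOfEquivSpanSingleton R V x).toLinearMap
  have hf : Function.Injective f :=
    Subtype.val_injective.comp (Ideal.quotTorsionOfEquivSpanSingleton R V x).injective
  have hinj := Module.Flat.rTensor_preserves_injective_linearMap (M := U) f hf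
  have hw : ∀ w : U, x ⊗ₜ[R] w = 0 := fun w => by
    have := congrArg (LinearMap.lTensor V (LinearMap.mulLeft R w)) hx
    simpa using this
  refine subsingleton_of_forall_eq 0 fun t => hinj ?_
  rw [map_zero]
  induction t with
  | zero => simp
  | add a b ha hb => rw [map_add, ha, hb, add_zero]
  | tmul a w =>
    obtain ⟨a, rfl⟩ := Ideal.Quotient.mk_surjective a
    have : f (Ideal.Quotient.mk _ a) = a • x := by
      simp only [f, LinearMap.comp_apply, LinearEquiv.coe_coe, Submodule.subtype_apply]
      erw [Ideal.quotTorsionOfEquivSpanSingleton_apply_mk]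
      rfl
    rw [LinearMap.rTensor_tmul, this, TensorProduct.smul_tmul, hw]

/-- In `U ⊗ U` the epimorphism condition gives `y ⊗ 1 = 1 ⊗ y`, and `1` dies in the quotient. -/
theorem torsionOf_quotient_one_mem_relatedGabrielFilter [Module.Flat R U] [Algebra.IsEpi R U]
    (k : U ⧸ (1 : Submodule R U)) :
    Ideal.torsionOf R _ k ∈ relatedGabrielFilter R U := by
  obtain ⟨y, rfl⟩ := Submodule.mkQ_surjective _ k
  apply torsionOf_mem_relatedGabrielFilter
  have h := (Algebra.isEpi_iff_forall_one_tmul_eq R U).mp inferInstance y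
  have := congrArg (LinearMap.rTensor U (1 : Submodule R U).mkQ) h
  simp only [LinearMap.rTensor_tmul] at this
  have h1 : (1 : Submodule R U).mkQ 1 = 0 :=
    (Submodule.Quotient.mk_eq_zero _).mpr (Submodule.mem_one.mpr ⟨1, map_one _⟩)
  rw [← this, h1, TensorProduct.zero_tmul]

theorem mem_torsionOf_mkQ_one_iff {y : U} {r : R} :
    r ∈ Ideal.torsionOf R _ ((1 : Submodule R U).mkQ y) ↔ r • y ∈ (1 : Submodule R U) := by
  rw [Ideal.mem_torsionOf_iff, ← map_smul, Submodule.mkQ_apply, Submodule.Quotient.mk_eq_zero]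

/-- A finitely generated submodule of `U` is multiplied into the image of `R` by a finitely
generated ideal in the related Gabriel filter. -/
theorem exists_fg_smul_mem_one [Module.Flat R U] [Algebra.IsEpi R U] {X : Submodule R U}
    (hX : X.FG) : ∃ J : Ideal R, J.FG ∧ J ∈ relatedGabrielFilter R U ∧
      ∀ r ∈ J, ∀ y ∈ X, r • y ∈ (1 : Submodule R U) := by
  suffices ∃ J ∈ relatedGabrielFilter R U, ∀ r ∈ J, ∀ y ∈ X, r • y ∈ (1 : Submodule R U) by
    obtain ⟨I, hI, h⟩ := this
    obtain ⟨⟨J, hJ, hJf, hJm⟩, -⟩ := exists_fg_of_mem_relatedGabrielFilter hI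
    exact ⟨J, hJf, hJm, fun r hr => h r (hJ hr)⟩
  induction X, hX using Submodule.fg_induction with
  | singleton y =>
    refine ⟨_, torsionOf_quotient_one_mem_relatedGabrielFilter ((1 : Submodule R U).mkQ y),
      fun r hr z hz => ?_⟩
    obtain ⟨a, rfl⟩ := Submodule.mem_span_singleton.mp hz
    rw [smul_comm]
    exact Submodule.smul_mem _ _ (mem_torsionOf_mkQ_one_iff.mp hr)
  | sup X₁ X₂ _ _ ih₁ ih₂ =>
    obtain ⟨J₁, hJ₁, h₁⟩ := ih₁
    obtain ⟨J₂, hJ₂, h₂⟩ := ih₂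
    refine ⟨J₁ * J₂, mul_mem_relatedGabrielFilter hJ₁ hJ₂, fun r hr z hz => ?_⟩
    obtain ⟨a, ha, b, hb, rfl⟩ := Submodule.mem_sup.mp hz
    rw [smul_add]
    exact add_mem (h₁ r (Ideal.mul_le_left (I := J₁) (J := J₂) hr) a ha)
      (h₂ r (Ideal.mul_le_right (I := J₁) (J := J₂) hr) b hb)

end GabrielFilter

/-! ### Divisible modules and maps on finitely generated submodules -/

section Divisible

variable {R : Type u} {U : Type v} [CommRing R] [CommRing U] [Algebra R U]
  {M : Type w} [AddCommGroup M] [Module R M]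

theorem IsFilterDivisible.smul_top_eq_top {F : Set (Ideal R)} (hM : IsFilterDivisible F M)
    {I : Ideal R} (hI : I ∈ F) : I • (⊤ : Submodule R M) = ⊤ :=
  (subsingleton_quotient_tensor_iff I M).mp (hM I hI)

theorem IsUDivisible.isFilterDivisible (hM : IsUDivisible R U M) :
    IsFilterDivisible (relatedGabrielFilter R U) M := by
  obtain ⟨D, _, _, _, _, f, hf⟩ := hM
  intro I hI
  rw [subsingleton_quotient_tensor_iff, ← LinearMap.range_eq_top.mpr hf,
    ← Submodule.map_top f, ← Submodule.map_smul'']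
  congr 1
  refine eq_top_iff.mpr fun d _ => ?_
  have h1 : (1 : U) ∈ I • (⊤ : Submodule R U) := by
    rw [Ideal.smul_top_eq_map, mem_relatedGabrielFilter_iff.mp hI]
    exact Submodule.mem_top
  have := Submodule.mem_map_of_mem (f := (LinearMap.toSpanSingleton U D d).restrictScalars R) h1
  rw [Submodule.map_smul''] at this
  have h2 := Submodule.smul_mono (le_refl I) (le_top : Submodule.map
    ((LinearMap.toSpanSingleton U D d).restrictScalars R) ⊤ ≤ ⊤) this
  simpa using h2

/-- The kernel of `R → U` annihilates every `𝔾`-divisible module. -/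
theorem IsFilterDivisible.smul_eq_zero [Module.Flat R U]
    (hM : IsFilterDivisible (relatedGabrielFilter R U) M) {t : R} (ht : algebraMap R U t = 0)
    (m : M) : t • m = 0 := by
  have hG : Ideal.torsionOf R R t ∈ relatedGabrielFilter R U := by
    apply torsionOf_mem_relatedGabrielFilter
    apply (TensorProduct.lid R U).injective
    rw [TensorProduct.lid_tmul, Algebra.smul_def, ht, zero_mul, map_zero]
  have hm : m ∈ Ideal.torsionOf R R t • (⊤ : Submodule R M) := by
    rw [hM.smul_top_eq_top hG]
    exact Submodule.mem_top
  induction hm using Submodule.smul_induction_on' with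
  | smul r hr n _ =>
    have : t * r = 0 := by simpa [mul_comm] using hr
    rw [smul_smul, this, zero_smul]
  | add a _ b _ ha hb => rw [smul_add, ha, hb, add_zero]

theorem IsFilterDivisible.exists_one_extend [Module.Flat R U]
    (hM : IsFilterDivisible (relatedGabrielFilter R U) M) (m : M) :
    ∃ f : (1 : Submodule R U) →ₗ[R] M, ∀ (r : R) (h : algebraMap R U r ∈ (1 : Submodule R U)),
      f ⟨algebraMap R U r, h⟩ = r • m := by
  have hker : LinearMap.ker (Algebra.linearMap R U) ≤
      LinearMap.ker (LinearMap.toSpanSingleton R M m) := fun t ht =>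
    hM.smul_eq_zero (U := U) ht m
  let e := (Algebra.linearMap R U).quotKerEquivRange
  refine ⟨(Submodule.liftQ _ _ hker) ∘ₗ e.symm.toLinearMap ∘ₗ
    (LinearEquiv.ofEq _ _ Submodule.one_eq_range).toLinearMap, fun r h => ?_⟩
  have : e.symm (LinearEquiv.ofEq _ _ Submodule.one_eq_range ⟨algebraMap R U r, h⟩) =
      Submodule.Quotient.mk r := by
    rw [LinearEquiv.symm_apply_eq]
    rfl
  simp only [LinearMap.comp_apply, LinearEquiv.coe_coe, this]
  rw [Submodule.liftQ_apply, LinearMap.toSpanSingleton_apply]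

/-- Every element of a `𝔾`-divisible module is the image of `1` under a homomorphism defined on a
given finitely generated submodule of `U`. -/
theorem IsFilterDivisible.exists_fg_extend [Module.Flat R U] [Algebra.IsEpi R U]
    (hM : IsFilterDivisible (relatedGabrielFilter R U) M) {X : Submodule R U} (hX : X.FG) (m : M) :
    ∃ f : X →ₗ[R] M, ∀ (r : R) (h : algebraMap R U r ∈ X),
      f ⟨algebraMap R U r, h⟩ = r • m := by
  obtain ⟨J, -, hJ, hJX⟩ := exists_fg_smul_mem_one hX
  have hm : m ∈ J • (⊤ : Submodule R M) := by
    rw [hM.smul_top_eq_top hJ]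
    exact Submodule.mem_top
  -- For `m = ∑ jᵢ nᵢ` the map is `y ↦ ∑ gᵢ (jᵢ y)`, where `gᵢ` is defined on the image of `R` and
  -- sends `1` to `nᵢ`.
  induction hm using Submodule.smul_induction_on' with
  | smul j hj n _ =>
    obtain ⟨g, hg⟩ := hM.exists_one_extend n
    refine ⟨g ∘ₗ ((LinearMap.lsmul R U j).restrict (p := X) (q := 1) fun y hy => hJX j hj y hy),
      fun r h => ?_⟩
    have : (LinearMap.lsmul R U j).restrict (p := X) (q := 1) (fun y hy => hJX j hj y hy)
        ⟨algebraMap R U r, h⟩ = ⟨algebraMap R U (r * j), Submodule.algebraMap_mem _⟩ :=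
      Subtype.ext (by
        change j • algebraMap R U r = algebraMap R U (r * j)
        rw [Algebra.smul_def, mul_comm, map_mul])
    rw [LinearMap.comp_apply, this, hg, mul_smul]
  | add a _ b _ ha hb =>
    obtain ⟨f, hf⟩ := ha
    obtain ⟨g, hg⟩ := hb
    exact ⟨f + g, fun r h => by rw [LinearMap.add_apply, hf, hg, smul_add]⟩

end Divisible

/-! ### Extension to countably generated submodules -/

section Extension

theorem Submodule.FG.exists_fg_le_ker {R V W : Type*} [CommRing R] [AddCommGroup V] [Module R V]
    [AddCommGroup W] [Module R W] (x : V →ₗ[R] W) (e : V) {S : Submodule R V} (hS : S.FG)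
    (h : ∀ s ∈ S, x s ∈ Submodule.span R {x e}) :
    ∃ K ≤ LinearMap.ker x, K.FG ∧ ∀ s ∈ S, ∃ r : R, s - r • e ∈ K := by
  induction S, hS using Submodule.fg_induction with
  | singleton s =>
    obtain ⟨r, hr⟩ := Submodule.mem_span_singleton.mp (h s (Submodule.mem_span_singleton_self s))
    refine ⟨Submodule.span R {s - r • e}, ?_, ⟨{s - r • e}, by simp⟩, fun t ht => ?_⟩
    · rw [Submodule.span_singleton_le_iff_mem, LinearMap.mem_ker, map_sub, map_smul, hr, sub_self]
    · obtain ⟨a, rfl⟩ := Submodule.mem_span_singleton.mp ht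
      refine ⟨a * r, ?_⟩
      rw [mul_smul, ← smul_sub]
      exact Submodule.smul_mem _ _ (Submodule.mem_span_singleton_self _)
  | sup S₁ S₂ _ _ h₁ h₂ =>
    obtain ⟨K₁, hK₁, hf₁, h₁⟩ := h₁ fun s hs => h s (Submodule.mem_sup_left hs)
    obtain ⟨K₂, hK₂, hf₂, h₂⟩ := h₂ fun s hs => h s (Submodule.mem_sup_right hs)
    refine ⟨K₁ ⊔ K₂, sup_le hK₁ hK₂, Submodule.FG.sup hf₁ hf₂, fun s hs => ?_⟩
    obtain ⟨a, ha, b, hb, rfl⟩ := Submodule.mem_sup.mp hs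
    obtain ⟨r, hr⟩ := h₁ a ha
    obtain ⟨r', hr'⟩ := h₂ b hb
    refine ⟨r + r', ?_⟩
    rw [add_smul, add_sub_add_comm]
    exact add_mem (Submodule.mem_sup_left hr) (Submodule.mem_sup_right hr')

/-- The maps `F n` and `F (n + 1)` need to agree only on `Y n`, not on the whole domain `Y (n + 1)`
of `F n`; this is all that the Mittag-Leffler step supplies. -/
theorem LinearPMap.exists_extend_of_nat {R V W : Type*} [Ring R] [AddCommGroup V] [Module R V]
    [AddCommGroup W] [Module R W] {Y : ℕ → Submodule R V} (hY : ∀ n, Y n ≤ Y (n + 1))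
    (F : ∀ n, Y (n + 1) →ₗ[R] W)
    (hF : ∀ n z (hz : z ∈ Y n), F (n + 1) ⟨z, hY _ (hY _ hz)⟩ = F n ⟨z, hY _ hz⟩) :
    ∃ f : V →ₗ.[R] W, ∃ h : ∀ n, Y n ≤ f.domain,
      ∀ n z (hz : z ∈ Y n), f ⟨z, h n hz⟩ = F n ⟨z, hY _ hz⟩ := by
  let P : ℕ → (V →ₗ.[R] W) := fun n => ⟨Y n, F n ∘ₗ Submodule.inclusion (hY n)⟩
  have hP : Monotone P := monotone_nat_of_le_succ fun n =>
    LinearPMap.le_of_eqLocus_ge fun z hz => ⟨hz, hY n hz, (hF n z hz).symm⟩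
  have hdir : DirectedOn (· ≤ ·) (Set.range P) := directedOn_range.mpr hP.directed_le
  exact ⟨LinearPMap.sSup _ hdir, fun n => (LinearPMap.le_sSup hdir ⟨n, rfl⟩).1,
    fun n z hz => LinearPMap.sSup_apply hdir ⟨n, rfl⟩ ⟨z, hz⟩⟩

variable {R : Type u} {U : Type v} [CommRing R] [CommRing U] [Algebra R U]

theorem Submodule.fg_one : (1 : Submodule R U).FG := ⟨{1}, by simp [Submodule.one_eq_span]⟩

variable [Module.Flat R U] [Algebra.IsEpi R U]

/-- The presentation of a finitely generated submodule `X` of `U` factors through a finite free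
module over `U`, in such a way that an ideal `J` in the related Gabriel filter maps the
factorization into the line spanned by the image of `1`. -/
theorem exists_factorization_of_fg {X : Submodule R U} (hX : X.FG) :
    ∃ (n k : ℕ) (x : (Fin n → R) →ₗ[R] U) (a : (Fin n → R) →ₗ[R] (Fin k →₀ R))
      (y : (Fin k →₀ R) →ₗ[R] U) (e : Fin n → R) (J : Ideal R),
      X ≤ LinearMap.range x ∧ x = y ∘ₗ a ∧ x e = 1 ∧ J ∈ relatedGabrielFilter R U ∧
      ∀ j ∈ J, ∀ z, ∃ r : R, a (j • z) = r • a e := by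
  have hX1 : (X ⊔ 1).FG := Submodule.FG.sup hX Submodule.fg_one
  have : Module.Finite R ↥(X ⊔ 1) := Module.Finite.iff_fg.mpr hX1
  obtain ⟨n, x₀, hx₀⟩ := Module.Finite.exists_fin' R ↥(X ⊔ 1)
  obtain ⟨e, he⟩ := hx₀ ⟨1, Submodule.mem_sup_right (Submodule.mem_one.mpr ⟨1, map_one _⟩)⟩
  obtain ⟨J, hJf, hJ, hJX⟩ := exists_fg_smul_mem_one hX1
  let x := (X ⊔ 1).subtype ∘ₗ x₀
  have hxe : x e = 1 := congrArg Subtype.val he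
  obtain ⟨K, hK, hKf, h⟩ := Submodule.FG.exists_fg_le_ker x e
    (S := J • (⊤ : Submodule R (Fin n → R))) (Submodule.FG.smul hJf Module.Finite.fg_top)
    (fun s hs => by
      rw [hxe, ← Submodule.one_eq_span]
      induction hs using Submodule.smul_induction_on' with
      | smul j hj z _ =>
        rw [map_smul]
        exact hJX j hj _ (x₀ z).2
      | add p _ q _ hp hq =>
        rw [map_add]
        exact add_mem hp hq)
  have : Module.Finite R K := Module.Finite.iff_fg.mpr hKf
  -- Flatness: the finitely many relations in `K` are already killed by `a`.
  obtain ⟨k, a, y, hxy, ha⟩ := Module.Flat.exists_factorization_of_comp_eq_zero_of_free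
    (f := K.subtype) (x := x) (by ext z; exact hK z.2)
  refine ⟨n, k, x, a, y, e, J, fun z hz => ?_, hxy, hxe, hJ, fun j hj z => ?_⟩
  · obtain ⟨t, ht⟩ := hx₀ ⟨z, Submodule.mem_sup_left hz⟩
    exact ⟨t, congrArg Subtype.val ht⟩
  · obtain ⟨r, hr⟩ := h _ (Submodule.smul_mem_smul hj (Submodule.mem_top (x := z)))
    refine ⟨r, sub_eq_zero.mp ?_⟩
    rw [← map_smul a r, ← map_sub]
    exact DFunLike.congr_fun ha ⟨_, hr⟩

variable {M : Type w} [AddCommGroup M] [Module R M]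

/-- A Mittag-Leffler property of the homomorphisms from finitely generated submodules of `U` to a
`𝔾`-divisible module. -/
theorem IsFilterDivisible.exists_fg_extend_restrict
    (hM : IsFilterDivisible (relatedGabrielFilter R U) M) {X : Submodule R U} (hX : X.FG) :
    ∃ X' : Submodule R U, X'.FG ∧ ∃ h : X ≤ X', ∀ (f : X' →ₗ[R] M) (Y : Submodule R U), Y.FG →
      ∀ hXY : X ≤ Y, ∃ g : Y →ₗ[R] M, ∀ z (hz : z ∈ X), g ⟨z, hXY hz⟩ = f ⟨z, h hz⟩ := by
  obtain ⟨n, k, x, a, y, e, J, hXx, hxy, hxe, hJ, hJa⟩ := exists_factorization_of_fg hX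
  have hXy : X ≤ LinearMap.range y := hXx.trans (hxy ▸ LinearMap.range_comp_le_range a y)
  refine ⟨LinearMap.range y, (LinearMap.range_eq_map y) ▸ Module.Finite.fg_top.map y, hXy,
    fun f Y hY hXY => ?_⟩
  let P : ((Fin k →₀ R) →ₗ[R] M) → Prop := fun f' =>
    ∃ g : Y →ₗ[R] M, ∀ z (hz : x z ∈ Y), g ⟨x z, hz⟩ = f' (a z)
  have hadd : ∀ f₁ f₂, P f₁ → P f₂ → P (f₁ + f₂) := by
    rintro f₁ f₂ ⟨g₁, h₁⟩ ⟨g₂, h₂⟩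
    exact ⟨g₁ + g₂, fun z hz => by rw [LinearMap.add_apply, LinearMap.add_apply, h₁, h₂]⟩
  have hzero : P 0 := ⟨0, fun _ _ => rfl⟩
  -- Take `φ` with `φ 1 = f₁ (a e)` and let `g` be `φ` after multiplication by `j`. If `a (j • z) =
  -- r • a e`, then `j • x z = r • 1`, so `g (x z) = r • f₁ (a e) = j • f₁ (a z)`.
  have hsmul : ∀ j ∈ J, ∀ f₁, P (j • f₁) := by
    intro j hj f₁
    obtain ⟨φ, hφ⟩ := hM.exists_fg_extend (X := Y ⊔ Y.map (LinearMap.lsmul R U j))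
      (Submodule.FG.sup hY (hY.map _)) (f₁ (a e))
    have hmap : ∀ y ∈ Y, LinearMap.lsmul R U j y ∈ Y ⊔ Y.map (LinearMap.lsmul R U j) :=
      fun y hy => Submodule.mem_sup_right (Submodule.mem_map_of_mem hy)
    refine ⟨φ ∘ₗ (LinearMap.lsmul R U j).restrict hmap, fun z hz => ?_⟩
    obtain ⟨r, hr⟩ := hJa j hj z
    have hxr : j • x z = algebraMap R U r := by
      rw [← map_smul, hxy, LinearMap.comp_apply, hr, map_smul, ← LinearMap.comp_apply, ← hxy, hxe,
        Algebra.algebraMap_eq_smul_one]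
    have hmem : algebraMap R U r ∈ Y ⊔ Y.map (LinearMap.lsmul R U j) := hxr ▸ hmap _ hz
    have : (LinearMap.lsmul R U j).restrict hmap ⟨x z, hz⟩ = ⟨algebraMap R U r, hmem⟩ :=
      Subtype.ext hxr
    rw [LinearMap.comp_apply, this, hφ, LinearMap.smul_apply, ← map_smul f₁, ← map_smul f₁,
      ← map_smul a j, hr]
  -- Since `M = J M` and the source is finite free, every `f'` is a sum of maps `j • f₁`.
  have hP : ∀ f', P f' := by
    intro f'
    have hf' : f' = ∑ b, (Finsupp.lapply (R := R) b).smulRight (f' (Finsupp.single b 1)) := by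
      refine Finsupp.lhom_ext' fun c => LinearMap.ext_ring ?_
      simp [Finsupp.single_apply]
    rw [hf']
    refine Finset.sum_induction _ P hadd hzero fun b _ => ?_
    have hm : f' (Finsupp.single b 1) ∈ J • (⊤ : Submodule R M) := by
      rw [hM.smul_top_eq_top hJ]
      exact Submodule.mem_top
    generalize f' (Finsupp.single b 1) = p at hm
    induction hm using Submodule.smul_induction_on' with
    | smul j hj m _ =>
      have : (Finsupp.lapply (R := R) (M := R) b).smulRight (j • m) =
          j • (Finsupp.lapply (R := R) b).smulRight m :=
        LinearMap.ext fun c => smul_comm (c b) j m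
      rw [this]
      exact hsmul j hj _
    | add p _ q _ hp hq =>
      have : (Finsupp.lapply (R := R) (M := R) b).smulRight (p + q) =
          (Finsupp.lapply (R := R) b).smulRight p + (Finsupp.lapply (R := R) b).smulRight q := by
        ext; simp
      rw [this]
      exact hadd _ _ hp hq
  obtain ⟨g, hg⟩ := hP (f ∘ₗ y.rangeRestrict)
  refine ⟨g, fun z hz => ?_⟩
  obtain ⟨t, rfl⟩ := hXx hz
  rw [hg, LinearMap.comp_apply]
  congr 1
  exact Subtype.ext (LinearMap.congr_fun hxy t).symm

/-- Every element of a `𝔾`-divisible module is the image of `1` under a homomorphism defined on a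
given countably generated submodule of `U`. -/
theorem IsFilterDivisible.exists_countable_extend
    (hM : IsFilterDivisible (relatedGabrielFilter R U) M) (C : ℕ → Submodule R U)
    (hC : ∀ n, (C n).FG) (m : M) :
    ∃ f : U →ₗ.[R] M, (∀ n, C n ≤ f.domain) ∧
      ∀ (r : R) (h : algebraMap R U r ∈ f.domain), f ⟨algebraMap R U r, h⟩ = r • m := by
  choose! E hEf hE hEM using
    fun (X : Submodule R U) (hX : X.FG) => hM.exists_fg_extend_restrict hX
  obtain ⟨Y, hY0, hYs⟩ : ∃ Y : ℕ → Submodule R U, Y 0 = 1 ∧ ∀ n, Y (n + 1) = E (Y n) ⊔ C n :=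
    ⟨Nat.rec 1 fun n Z => E Z ⊔ C n, rfl, fun _ => rfl⟩
  have hY : ∀ n, (Y n).FG := by
    intro n
    induction n with
    | zero => exact hY0 ▸ Submodule.fg_one
    | succ n ih => exact hYs n ▸ Submodule.FG.sup (hEf _ ih) (hC n)
  have hEY : ∀ n, E (Y n) ≤ Y (n + 1) := fun n => hYs n ▸ le_sup_left
  have hmono : ∀ n, Y n ≤ Y (n + 1) := fun n => (hE _ (hY n)).trans (hEY n)
  have hstep : ∀ n (f : Y (n + 1) →ₗ[R] M), ∃ g : Y (n + 1 + 1) →ₗ[R] M,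
      ∀ z (hz : z ∈ Y n), g ⟨z, hmono _ (hmono _ hz)⟩ = f ⟨z, hmono _ hz⟩ := fun n f =>
    hEM _ (hY n) (f ∘ₗ Submodule.inclusion (hEY n)) _ (hY (n + 2))
      ((hmono _).trans (hmono _))
  choose step hstep using hstep
  obtain ⟨f₀, hf₀⟩ := hM.exists_fg_extend (hY 1) m
  obtain ⟨F, hF0, hFs⟩ : ∃ F : ∀ n, Y (n + 1) →ₗ[R] M, F 0 = f₀ ∧
      ∀ n, F (n + 1) = step n (F n) := ⟨Nat.rec f₀ step, rfl, fun _ => rfl⟩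
  obtain ⟨f, hf, hfF⟩ := LinearPMap.exists_extend_of_nat hmono F fun n z hz => by
    rw [hFs, hstep n _ z hz]
  have h1 : (1 : Submodule R U) ≤ Y 0 := hY0.ge
  refine ⟨f, fun n => (hYs n ▸ le_sup_right : C n ≤ Y (n + 1)).trans (hf _), fun r h => ?_⟩
  rw [hfF 0 _ (h1 (Submodule.algebraMap_mem r)), hF0, hf₀]

end Extension

/-! ### Primary parts of modules -/

section RadicalTorsion

/-- A semilocal zero-dimensional ring has, for each maximal ideal `p`, an idempotent outside `p`
whose product with any element of `p` is nilpotent. -/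
theorem IsZeroDimensional.exists_isIdempotentElem {T : Type*} [CommRing T]
    (hT : IsZeroDimensional T) (hfin : IsSemilocal T) (p : Ideal T) [p.IsPrime] :
    ∃ e : T, IsIdempotentElem e ∧ e ∉ p ∧ ∀ t ∈ p, IsNilpotent (e * t) := by
  have : Ring.KrullDimLE 0 T := .mk₀ hT
  have : Finite (MaximalSpectrum T) := hfin
  have : Finite (PrimeSpectrum T) := Finite.of_injective
    (fun q : PrimeSpectrum T => (⟨q.asIdeal, hT _ q.isPrime⟩ : MaximalSpectrum T))
    fun q q' h => PrimeSpectrum.ext (congrArg MaximalSpectrum.asIdeal h)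
  have : DiscreteTopology (PrimeSpectrum T) :=
    PrimeSpectrum.discreteTopology_iff_finite_and_krullDimLE_zero.mpr ⟨inferInstance, inferInstance⟩
  let P : PrimeSpectrum T := ⟨p, inferInstance⟩
  obtain ⟨e, he, hP⟩ := PrimeSpectrum.exists_idempotent_basicOpen_eq_of_isClopen
    (isClopen_discrete {P})
  have hmem : ∀ q : PrimeSpectrum T, e ∉ q.asIdeal ↔ q = P := fun q =>
    (PrimeSpectrum.mem_basicOpen e q).symm.trans (Set.ext_iff.mp hP q).symm
  refine ⟨e, he, (hmem P).mpr rfl, fun t ht => ?_⟩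
  rw [← mem_nilradical, nilradical_eq_sInf, Submodule.mem_sInf]
  intro q hq
  by_cases h : e ∈ q
  · exact Ideal.mul_mem_right t q h
  · have : (⟨q, hq⟩ : PrimeSpectrum T) = P := (hmem ⟨q, hq⟩).mp h
    have hqp : q = p := congrArg PrimeSpectrum.asIdeal this
    exact Ideal.mul_mem_left q e (hqp ▸ ht)

variable {R : Type u} [CommRing R]

theorem exists_idempotent_mod_of_isZeroDimensional {I p : Ideal R} [p.IsPrime] (hIp : I ≤ p)
    (hfin : IsSemilocal (R ⧸ I)) (hdim : IsZeroDimensional (R ⧸ I)) :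
    ∃ e ∉ p, ∀ t ∈ p, ∃ n : ℕ, e * t ^ n ∈ I := by
  have hker : RingHom.ker (Ideal.Quotient.mk I) ≤ p := by rwa [Ideal.mk_ker]
  have : (p.map (Ideal.Quotient.mk I)).IsPrime :=
    Ideal.map_isPrime_of_surjective Ideal.Quotient.mk_surjective hker
  obtain ⟨e, he, hep, h⟩ := hdim.exists_isIdempotentElem hfin (p.map (Ideal.Quotient.mk I))
  obtain ⟨e, rfl⟩ := Ideal.Quotient.mk_surjective e
  refine ⟨e, fun hp => hep (Ideal.mem_map_of_mem _ hp), fun t ht => ?_⟩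
  obtain ⟨n, hn⟩ := h _ (Ideal.mem_map_of_mem _ ht)
  -- The exponent is positive so that idempotence yields `e * t ^ (n + 1) = (e * t) ^ (n + 1)`, even
  -- for `n = 0`.
  refine ⟨n + 1, Ideal.Quotient.eq_zero_iff_mem.mp ?_⟩
  rw [map_mul, map_pow, ← he.pow_succ_eq n, ← mul_pow, pow_succ, hn, zero_mul]

variable (V : Type*) [AddCommGroup V] [Module R V]

/-- The elements of a module annihilated by a power of each element of the ideal `p`. -/
def radicalTorsion (p : Ideal R) : Submodule R V where
  carrier := {x | ∀ t ∈ p, ∃ n : ℕ, t ^ n • x = 0}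
  zero_mem' _ _ := ⟨0, smul_zero _⟩
  add_mem' := by
    intro x y hx hy t ht
    obtain ⟨n, hn⟩ := hx t ht
    obtain ⟨k, hk⟩ := hy t ht
    refine ⟨n + k, ?_⟩
    rw [smul_add, pow_add, mul_comm, mul_smul, hn, mul_comm, mul_smul, hk, smul_zero, smul_zero,
      add_zero]
  smul_mem' := by
    intro r x hx t ht
    obtain ⟨n, hn⟩ := hx t ht
    exact ⟨n, by rw [smul_comm, hn, smul_zero]⟩

theorem iSupIndep_radicalTorsion {ι : Type*} (p : ι → Ideal R) (hp : ∀ i, (p i).IsMaximal)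
    (hinj : Function.Injective p) : iSupIndep fun i => radicalTorsion V (p i) := by
  intro i
  rw [Submodule.disjoint_def]
  intro x hx hx'
  obtain ⟨s, hs, hsx⟩ : ∃ s ∉ p i, s • x = 0 := by
    refine Submodule.iSup_induction _ (motive := fun y => ∃ s ∉ p i, s • y = 0) hx'
      (fun j y hy => ?_)
      ⟨1, (Ideal.ne_top_iff_one _).mp (hp i).ne_top, smul_zero _⟩ ?_
    · by_cases hj : j = i
      · subst hj
        have : y = 0 := by simpa using hy
        exact ⟨1, (Ideal.ne_top_iff_one _).mp (hp j).ne_top, by rw [this, smul_zero]⟩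
      · replace hy : y ∈ radicalTorsion V (p j) := by simpa [hj] using hy
        obtain ⟨s, hs, hsi⟩ : ∃ s ∈ p j, s ∉ p i := SetLike.not_le_iff_exists.mp fun hle =>
          hj (hinj ((hp j).eq_of_le (hp i).ne_top hle))
        obtain ⟨n, hn⟩ := hy s hs
        exact ⟨s ^ n, fun h => hsi ((hp i).isPrime.mem_of_pow_mem n h), hn⟩
    · rintro y z ⟨s, hs, hy⟩ ⟨t, ht, hz⟩
      refine ⟨s * t, fun h => ((hp i).isPrime.mem_or_mem h).elim hs ht, ?_⟩
      rw [smul_add, mul_smul, mul_smul, hz, smul_comm, hy, smul_zero, smul_zero, add_zero]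
  -- The radical of the annihilator contains the maximal ideal `p i` and also `s ∉ p i`.
  have htop : Ideal.torsionOf R V x = ⊤ := by
    by_contra hne
    have hle : p i ≤ (Ideal.torsionOf R V x).radical := fun t ht => hx t ht
    have hrad := (hp i).eq_of_le (fun h => hne (Ideal.radical_eq_top.mp h)) hle
    exact hs (hrad ▸ Ideal.le_radical hsx)
  simpa using (Ideal.eq_top_iff_one _).mp htop

end RadicalTorsion

/-! ### Gluing along a direct sum decomposition -/

section Gluing

/-- Compatible homomorphisms defined on submodules of `V` whose images in `V ⧸ N` form a direct
sum decomposition glue to a homomorphism defined on `V`. -/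
theorem LinearMap.exists_extend_of_iSupIndep {R V M ι : Type*} [CommRing R] [AddCommGroup V]
    [Module R V] [AddCommGroup M] [Module R M] {N : Submodule R V} (θ : N →ₗ[R] M)
    {W : ι → Submodule R (V ⧸ N)} (hind : iSupIndep W) (hsup : ⨆ i, W i = ⊤)
    (f : ∀ i, (W i).comap N.mkQ →ₗ[R] M)
    (hf : ∀ i z (hz : z ∈ N) (hz' : z ∈ (W i).comap N.mkQ), f i ⟨z, hz'⟩ = θ ⟨z, hz⟩) :
    ∃ g : V →ₗ[R] M, ∀ z : N, g z = θ z := by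
  classical
  let S : (N × Π₀ i, (W i).comap N.mkQ) →ₗ[R] V :=
    N.subtype.coprod (DFinsupp.lsum ℕ fun i => ((W i).comap N.mkQ).subtype)
  let Φ : (N × Π₀ i, (W i).comap N.mkQ) →ₗ[R] M := θ.coprod (DFinsupp.lsum ℕ f)
  have hcomp : (DFinsupp.lsum ℕ fun i => (W i).subtype) ∘ₗ (DFinsupp.mapRange.linearMap
      fun i => N.mkQ.restrict (p := (W i).comap N.mkQ) (q := W i) fun _ h => h) =
      N.mkQ ∘ₗ DFinsupp.lsum ℕ fun i => ((W i).comap N.mkQ).subtype := by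
    ext i z
    simp
  have hker : LinearMap.ker S ≤ LinearMap.ker Φ := by
    rintro ⟨a, z⟩ hz
    replace hz : (a : V) + DFinsupp.lsum ℕ (fun i => ((W i).comap N.mkQ).subtype) z = 0 := hz
    have hz0 : DFinsupp.lsum ℕ (fun i => (W i).subtype)
        (DFinsupp.mapRange.linearMap
          (fun i => N.mkQ.restrict (p := (W i).comap N.mkQ) (q := W i) fun _ h => h) z) = 0 := by
      rw [← LinearMap.comp_apply, hcomp, LinearMap.comp_apply, ← neg_eq_of_add_eq_zero_right hz]
      exact (Submodule.Quotient.mk_eq_zero N).mpr (neg_mem a.2)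
    -- Independence forces each component of a relation into `N`, where every `f i` equals `θ`;
    -- hence `Φ` kills `ker S` and descends to `V`.
    have hzN : ∀ i, (z i : V) ∈ N := fun i => by
      have h := hind.dfinsupp_lsum_injective (hz0.trans (map_zero _).symm)
      have := congrArg Subtype.val (DFunLike.congr_fun h i)
      exact (Submodule.Quotient.mk_eq_zero N).mp this
    have hΦ : DFinsupp.lsum ℕ f z = ∑ i ∈ z.support, θ ⟨z i, hzN i⟩ := by
      rw [DFinsupp.lsum_apply_apply, DFinsupp.sumAddHom_apply, DFinsupp.sum]
      exact Finset.sum_congr rfl fun i _ => hf i _ _ _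
    have hS : DFinsupp.lsum ℕ (fun i => ((W i).comap N.mkQ).subtype) z =
        ((∑ i ∈ z.support, (⟨z i, hzN i⟩ : N) : N) : V) := by
      rw [DFinsupp.lsum_apply_apply, DFinsupp.sumAddHom_apply, DFinsupp.sum,
        AddSubmonoidClass.coe_finsetSum]
      rfl
    rw [hS, ← Submodule.coe_add, Submodule.coe_eq_zero] at hz
    change θ a + DFinsupp.lsum ℕ f z = 0
    rw [hΦ, ← map_sum, ← map_add, hz, map_zero]
  have hsurj : Function.Surjective S := by
    have hle : ⨆ i, W i ≤ (LinearMap.range S).map N.mkQ := iSup_le fun i w hw => by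
      obtain ⟨z, rfl⟩ := N.mkQ_surjective w
      exact Submodule.mem_map_of_mem ⟨(0, DFinsupp.single i ⟨z, hw⟩), by simp [S]⟩
    intro v
    obtain ⟨_, ⟨a, rfl⟩, ha⟩ := hle (hsup ▸ Submodule.mem_top : N.mkQ v ∈ ⨆ i, W i)
    have hv : v - S a ∈ N := (Submodule.Quotient.eq N).mp ha.symm
    refine ⟨(⟨v - S a, hv⟩, 0) + a, ?_⟩
    rw [map_add]
    simp [S]
  refine ⟨(LinearMap.ker S).liftQ Φ hker ∘ₗ (S.quotKerEquivOfSurjective hsurj).symm.toLinearMap,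
    fun z => ?_⟩
  have : (S.quotKerEquivOfSurjective hsurj).symm (z : V) = Submodule.Quotient.mk (z, 0) := by
    rw [LinearEquiv.symm_apply_eq]
    change (z : V) = S (z, 0)
    simp [S]
  rw [LinearMap.comp_apply, LinearEquiv.coe_coe, this, Submodule.liftQ_apply]
  simp [Φ]

end Gluing

/-! ### Primary decomposition of `U ⧸ 1` and the conclusion -/

section Main

variable {R : Type u} {U : Type v} [CommRing R] [CommRing U] [Algebra R U]

variable [Module.Flat R U] [Algebra.IsEpi R U]

/-- Otherwise the ideal carrying `k` into the sum lies in a maximal `p`, which contains the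
annihilator of `k` and so belongs to `𝔾`. The idempotent at `p` lifts to some `e ∉ p` with `e • k`
in the `p`-part, a contradiction. -/
theorem IsHNil.iSup_radicalTorsion (h : IsHNil (relatedGabrielFilter R U)) :
    ⨆ p : {p : Ideal R // p.IsMaximal ∧ p ∈ relatedGabrielFilter R U},
      radicalTorsion (U ⧸ (1 : Submodule R U)) p.1 = ⊤ := by
  refine eq_top_iff.mpr fun k _ => ?_
  by_contra hk
  have hne : Submodule.comap (LinearMap.toSpanSingleton R _ k)
      (⨆ p : {p : Ideal R // p.IsMaximal ∧ p ∈ relatedGabrielFilter R U},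
        radicalTorsion (U ⧸ (1 : Submodule R U)) p.1) ≠ ⊤ := fun htop => hk <| by
    have := (Ideal.eq_top_iff_one _).mp htop
    rwa [Submodule.mem_comap, LinearMap.toSpanSingleton_apply, one_smul] at this
  obtain ⟨p, hp, hle⟩ := Ideal.exists_le_maximal _ hne
  have hkG := torsionOf_quotient_one_mem_relatedGabrielFilter k
  have hkp : Ideal.torsionOf R _ k ≤ p := fun r hr => hle <| by
    rw [Submodule.mem_comap, LinearMap.toSpanSingleton_apply, (Ideal.mem_torsionOf_iff _ _).mp hr]
    exact zero_mem _
  obtain ⟨e, hep, he⟩ := exists_idempotent_mod_of_isZeroDimensional hkp (h _ hkG).1 (h _ hkG).2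
  refine hep (hle ?_)
  rw [Submodule.mem_comap, LinearMap.toSpanSingleton_apply]
  refine Submodule.mem_iSup_of_mem ⟨p, hp, relatedGabrielFilter_mono hkG hkp⟩ fun t ht => ?_
  obtain ⟨n, hn⟩ := he t ht
  exact ⟨n, by rw [smul_smul, mul_comm]; exact hn⟩

variable {M : Type w} [AddCommGroup M] [Module R M]

/-- For a finitely generated `I ≤ p` in `𝔾`, every element of the `p`-part is killed by some `I ^
n`, so its lifts to `U` lie in the finitely generated `X n`. -/
theorem IsFilterDivisible.exists_extend_radicalTorsion
    (hM : IsFilterDivisible (relatedGabrielFilter R U) M) (m : M) {p : Ideal R}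
    (hp : p ∈ relatedGabrielFilter R U) :
    ∃ f : (radicalTorsion (U ⧸ (1 : Submodule R U)) p).comap (1 : Submodule R U).mkQ →ₗ[R] M,
      ∀ r hr, f ⟨algebraMap R U r, hr⟩ = r • m := by
  obtain ⟨⟨I, hIp, hIf, hI⟩, -⟩ := exists_fg_of_mem_relatedGabrielFilter hp
  choose X hX hXI using fun n : ℕ =>
    (exists_fg_of_mem_relatedGabrielFilter (pow_mem_relatedGabrielFilter hI n)).2
  obtain ⟨f, hf, hfm⟩ := hM.exists_countable_extend X hX m
  have hle : (radicalTorsion (U ⧸ (1 : Submodule R U)) p).comap (1 : Submodule R U).mkQ ≤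
      f.domain := fun z hz => by
    obtain ⟨n, hn⟩ := Ideal.exists_pow_le_of_le_radical_of_fg
      (J := Ideal.torsionOf R _ ((1 : Submodule R U).mkQ z)) (fun t ht => hz t (hIp ht)) hIf
    exact hf n (hXI n z fun r hr => mem_torsionOf_mkQ_one_iff.mp (hn hr))
  exact ⟨f.toFun ∘ₗ Submodule.inclusion hle, fun r hr => hfm r _⟩

theorem IsHNil.exists_linearMap_apply_one_eq (h : IsHNil (relatedGabrielFilter R U))
    (hM : IsFilterDivisible (relatedGabrielFilter R U) M) (m : M) :
    ∃ f : U →ₗ[R] M, f 1 = m := by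
  obtain ⟨θ, hθ⟩ := hM.exists_one_extend m
  choose f hf using fun p : {p : Ideal R // p.IsMaximal ∧ p ∈ relatedGabrielFilter R U} =>
    hM.exists_extend_radicalTorsion m p.2.2
  obtain ⟨g, hg⟩ := LinearMap.exists_extend_of_iSupIndep θ
    (iSupIndep_radicalTorsion (U ⧸ (1 : Submodule R U)) _ (fun p => p.2.1) Subtype.val_injective)
    h.iSup_radicalTorsion f (by
      intro p z hz hz'
      obtain ⟨r, rfl⟩ := Submodule.mem_one.mp hz
      rw [hf, hθ])
  refine ⟨g, ?_⟩
  have h1 := hg ⟨algebraMap R U 1, Submodule.algebraMap_mem 1⟩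
  rw [hθ, one_smul] at h1
  rwa [← map_one (algebraMap R U)]

end Main

theorem corollary4p5 (R : Type u) (U : Type v) [CommRing R] [CommRing U] [Algebra R U]
    [Module.Flat R U] [Algebra.IsEpi R U] (h : IsHNil (relatedGabrielFilter R U))
    (M : Type w) [AddCommGroup M] [Module R M] :
    IsUDivisible R U M ↔ IsFilterDivisible (relatedGabrielFilter R U) M := by
  refine ⟨IsUDivisible.isFilterDivisible, fun hM => ?_⟩
  choose f hf using fun m : M => h.exists_linearMap_apply_one_eq hM m
  refine isUDivisible_of_surjective (D := M →₀ U) (Finsupp.lsum R f) fun m =>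
    ⟨Finsupp.single m 1, ?_⟩
  rw [Finsupp.lsum_single, hf]
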